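/- An $r$-coloring of $[\mathbb{N}]^2$ is a function $c$ assigning to each two-element set $\{x,y\}\subseteq\mathbb{N}$ a color in $\{0,\dots,r-1\}$; it is stable if $\lim_{y\to\infty} c(\{x,y\})$ exists for every $x\in\mathbb{N}$. A path of color $k$ for $c$ is a finite (possibly empty) or infinite list $a_0,a_1,a_2,\dots$ of distinct natural numbers such that $c(\{a_{i-1},a_i\})=k$ for all $i\ge 1$ for which $a_i$ is in the list. A path decomposition for $c$ is a tuple $(P_0,\dots,P_{r-1})$ such that each $P_j$ is a path of color $j$ and every natural number appears on exactly one of the paths $P_0,\dots,P_{r-1}$. The halting set is $K=\{e\in\mathbb{N} : \varphi_e(e)\text{ is defined}\}$, where $\varphi_e$ is the partial computable function with code $e$. **Theorem.** There is a computable stable $2$-coloring $c$ of $[\mathbb{N}]^2$ such that every path decomposition $P=(P_0,P_1)$ for $c$ computes the halting set; that is, $K$ is Turing reducible to the set of (codes of) triples $(j,n,x)$ such that $x$ is the $n$-th entry of $P_j$. -/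

import Mathlib

namespace RadoPath

/-- An `r`-coloring of the two-element subsets of `ℕ`, i.e. of the edges of the complete graph
on `ℕ`. The color of `{x, y}`, where `h : x ≠ y`, is `c.get x y h`. -/
abbrev Coloring (r : ℕ) := SimpleGraph.TopEdgeLabeling ℕ (Fin r)

/-- `c` is computable: some computable function of two arguments returns the color of `{x, y}`
for all `x ≠ y`. -/
def Coloring.IsComputable {r : ℕ} (c : Coloring r) : Prop :=
  ∃ f : ℕ → ℕ → Fin r, Computable₂ f ∧ ∀ (x y : ℕ) (h : x ≠ y), f x y = c.get x y h

/-- `c` is stable: for every `x` the limit of the color of `{x, y}` as `y → ∞` exists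
(in the discrete set of colors, so that the color is eventually constant). -/
def Coloring.IsStable {r : ℕ} (c : Coloring r) : Prop :=
  ∀ x : ℕ, ∃ k : Fin r, ∀ᶠ y in Filter.atTop, ∀ h : x ≠ y, c.get x y h = k

/-- The finite or infinite (possibly empty) list `P` is a monochromatic path of color `k`: its
entries are distinct and any two consecutive ones form a pair of color `k`. -/
structure IsPath {r : ℕ} (c : Coloring r) (k : Fin r) (P : Stream'.Seq ℕ) : Prop where
  distinct : ∀ m n a : ℕ, P.get? m = some a → P.get? n = some a → m = n
  color : ∀ n a b : ℕ, P.get? n = some a → P.get? (n + 1) = some b →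
    ∀ h : a ≠ b, c.get a b h = k

/-- `P 0, …, P (r - 1)` is a path decomposition for `c`: `P j` is a path of color `j`, and every
natural number appears on exactly one of the paths. -/
structure IsPathDecomposition {r : ℕ} (c : Coloring r) (P : Fin r → Stream'.Seq ℕ) : Prop where
  isPath : ∀ j : Fin r, IsPath c j (P j)
  covers : ∀ x : ℕ, ∃! j : Fin r, ∃ n : ℕ, (P j).get? n = some x

open Classical in
/-- The characteristic function of a set of natural numbers, as a (total) oracle. -/
noncomputable def charFn (A : Set ℕ) : ℕ →. ℕ :=
  fun n => Part.some (if n ∈ A then 1 else 0)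

/-- `B` computes `A`, i.e. `A` is Turing reducible to `B`. -/
def Computes (B A : Set ℕ) : Prop :=
  TuringReducible (charFn A) (charFn B)

/-- The set of natural numbers coding a tuple of finite or infinite lists: the joint graph of the
lists, i.e. the codes of the triples `(j, n, x)` such that `x` is the `n`-th entry of `P j`. -/
def graphSet {r : ℕ} (P : Fin r → Stream'.Seq ℕ) : Set ℕ :=
  {q | ∃ (j : Fin r) (n x : ℕ), (P j).get? n = some x ∧
    q = Nat.pair (j : ℕ) (Nat.pair n x)}

/-- The halting set `K`: the `e` such that the program with code `e` halts on input `e`. -/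
def haltingSet : Set ℕ :=
  {e | ((Denumerable.ofNat Nat.Partrec.Code e).eval e).Dom}

end RadoPath

namespace RadoPath

open Encodable
open Nat.Partrec (Code)

/-! Let `g s` be the least number entering the halting set at stage `s + 1`, capped by `s`. At a
true stage `s` (no later value of `g` is smaller) the halting set below `g s` is settled, and `g`
tends to infinity, so arbitrarily late true stages suffice to decide it.

The numbers with `Nat.log 4 x = s` stand for stage `s`, and an edge has color 0 when the smaller
stage still looks true at the larger one. If `s` is true, a number of stage `s` has color 0 to
everything from `4 ^ s` on, so on path 1 it is first or preceded by a number below `4 ^ s`. There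
are too few of those, so path 0 meets `[4 ^ s, ∞)` (`exists_get_zero_of_isTrueStage`) and is
infinite (`exists_get_zero`).

An entry of path 0 below all later entries has a true stage: looking true propagates along the path
(`isTrueStage_of_forall_gt`). Such entries occur arbitrarily high, and a finite part of the
decomposition certifies one by locating every smaller number on path 1 or earlier on path 0
(`IsWitness`). Searching for a certificate decides the halting set. -/

/-! ### Relative computability by searching in finite parts of the oracle -/

open Classical in
/-- The list of the members of `B` below `n`. -/
noncomputable def membersBelow (B : Set ℕ) : ℕ → List ℕ
  | 0 => []
  | n + 1 => if n ∈ B then n :: membersBelow B n else membersBelow B n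

theorem mem_membersBelow {B : Set ℕ} {n x : ℕ} : x ∈ membersBelow B n ↔ x ∈ B ∧ x < n := by
  induction n with
  | zero => simp [membersBelow]
  | succ n ih =>
    by_cases h : n ∈ B
    · simp only [membersBelow, h, if_true, List.mem_cons, ih]
      constructor
      · rintro (rfl | ⟨h1, h2⟩)
        · exact ⟨h, by omega⟩
        · exact ⟨h1, by omega⟩
      · rintro ⟨h1, h2⟩
        by_cases hx : x = n
        · exact Or.inl hx
        · exact Or.inr ⟨h1, by omega⟩
    · simp only [membersBelow, h, if_false, ih]
      constructor
      · rintro ⟨h1, h2⟩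
        exact ⟨h1, by omega⟩
      · rintro ⟨h1, h2⟩
        have : x ≠ n := fun hx => h (hx ▸ h1)
        exact ⟨h1, by omega⟩

theorem recursiveIn_comp {O : Set (ℕ →. ℕ)} {f h : ℕ → ℕ} (hf : Nat.RecursiveIn O (f : ℕ →. ℕ))
    (hh : Nat.RecursiveIn O (h : ℕ →. ℕ)) :
    Nat.RecursiveIn O ((fun n => f (h n) : ℕ → ℕ) : ℕ →. ℕ) :=
  (Nat.RecursiveIn.comp hf hh).of_eq fun n => Part.bind_some (h n) (f : ℕ →. ℕ)

theorem recursiveIn_pair {O : Set (ℕ →. ℕ)} {f h : ℕ → ℕ} (hf : Nat.RecursiveIn O (f : ℕ →. ℕ))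
    (hh : Nat.RecursiveIn O (h : ℕ →. ℕ)) :
    Nat.RecursiveIn O ((fun n => Nat.pair (f n) (h n) : ℕ → ℕ) : ℕ →. ℕ) :=
  (Nat.RecursiveIn.pair hf hh).of_eq fun n => by simp [Seq.seq]

theorem recursiveIn_of_primrec {O : Set (ℕ →. ℕ)} {f : ℕ → ℕ} (hf : Primrec f) :
    Nat.RecursiveIn O (f : ℕ →. ℕ) :=
  (Primrec.nat_iff.1 hf).recursiveIn

theorem recursiveIn_membersBelow (B : Set ℕ) :
    Nat.RecursiveIn {charFn B} ((fun n => encode (membersBelow B n) : ℕ → ℕ) : ℕ →. ℕ) := by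
  classical
  have horacle : Nat.RecursiveIn {charFn B} ((fun n => if n ∈ B then 1 else 0 : ℕ → ℕ) : ℕ →. ℕ) :=
    (Nat.RecursiveIn.oracle (O := {charFn B}) (charFn B) (Set.mem_singleton _)).of_eq fun n => by simp [charFn]
  have hy : Primrec fun p : ℕ => p.unpair.2.unpair.1 :=
    Primrec.fst.comp (Primrec.unpair.comp (Primrec.snd.comp Primrec.unpair))
  have hi : Primrec fun p : ℕ => p.unpair.2.unpair.2 :=
    Primrec.snd.comp (Primrec.unpair.comp (Primrec.snd.comp Primrec.unpair))
  -- `q` pairs the recursion data (parameter, counter, previous value) with the oracle's answer at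
  -- the counter; the successor of a pair is the code of a cons.
  have hstep : Primrec fun q : ℕ => if q.unpair.2 = 1 then
      Nat.succ (Nat.pair q.unpair.1.unpair.2.unpair.1 q.unpair.1.unpair.2.unpair.2)
      else q.unpair.1.unpair.2.unpair.2 := by
    have h1 : Primrec fun q : ℕ => q.unpair.1 := Primrec.fst.comp Primrec.unpair
    exact Primrec.ite (Primrec.eq.comp (Primrec.snd.comp Primrec.unpair) (Primrec.const 1))
      (Primrec.succ.comp (Primrec₂.natPair.comp (hy.comp h1) (hi.comp h1))) (hi.comp h1)
  have hh := recursiveIn_comp (recursiveIn_of_primrec (O := {charFn B}) hstep)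
    (recursiveIn_pair (recursiveIn_of_primrec Primrec.id)
      (recursiveIn_comp horacle (recursiveIn_of_primrec hy)))
  have hrec := Nat.RecursiveIn.prec (recursiveIn_of_primrec (O := {charFn B}) (Primrec.const 0)) hh
  refine (Nat.RecursiveIn.comp hrec (recursiveIn_of_primrec
    (Primrec₂.natPair.comp (Primrec.const 0) Primrec.id))).of_eq fun n => ?_
  simp only [id, PFun.coe_val, Part.bind_eq_bind, Part.bind_some, Nat.unpair_pair]
  induction n with
  | zero => simp [membersBelow]
  | succ n ih =>
    simp only [ih, Part.bind_some]
    by_cases h : n ∈ B <;> simp [membersBelow, h]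

/-- `A` is Turing reducible to `B` if membership of `e` in `A` can be read off primitive
recursively from every finite part of `B` that passes a primitive recursive test, and some finite
part does. -/
theorem computes_of_search {A B : Set ℕ} {H R : List ℕ → ℕ → Prop} (hH : PrimrecRel H)
    (hR : PrimrecRel R) (hex : ∀ e, ∃ n, H (membersBelow B n) e)
    (hcorrect : ∀ e n, H (membersBelow B n) e → (R (membersBelow B n) e ↔ e ∈ A)) :
    Computes B A := by
  classical
  rw [Computes, TuringReducible, RecursiveIn.iff_nat]
  have hl : Primrec fun p : ℕ => Denumerable.ofNat (List ℕ) p.unpair.1 :=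
    (Primrec.ofNat _).comp (Primrec.fst.comp Primrec.unpair)
  have he : Primrec fun p : ℕ => p.unpair.2 := Primrec.snd.comp Primrec.unpair
  -- Success is the value 0 because unbounded search looks for a zero.
  have htest : Primrec fun p : ℕ =>
      if H (Denumerable.ofNat (List ℕ) p.unpair.1) p.unpair.2 then 0 else 1 :=
    Primrec.ite (hH.comp hl he) (Primrec.const 0) (Primrec.const 1)
  have hout : Primrec fun p : ℕ =>
      if R (Denumerable.ofNat (List ℕ) p.unpair.1) p.unpair.2 then 1 else 0 :=
    Primrec.ite (hR.comp hl he) (Primrec.const 1) (Primrec.const 0)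
  have hfst : Primrec fun p : ℕ => p.unpair.1 := Primrec.fst.comp Primrec.unpair
  have hsearch := Nat.RecursiveIn.rfind (recursiveIn_comp
    (recursiveIn_of_primrec (O := {charFn B}) htest)
    (recursiveIn_pair (recursiveIn_comp (recursiveIn_membersBelow B) (recursiveIn_of_primrec he))
      (recursiveIn_of_primrec hfst)))
  have hfind : Nat.RecursiveIn {charFn B} ((fun e => Nat.find (hex e) : ℕ → ℕ) : ℕ →. ℕ) := by
    refine hsearch.of_eq_tot fun e => ?_
    refine Nat.mem_rfind.2 ⟨?_, fun {m} hm => ?_⟩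
    · simp [Nat.find_spec (hex e)]
    · simp [Nat.find_min (hex e) hm]
  refine (recursiveIn_comp (recursiveIn_of_primrec hout)
    (recursiveIn_pair (recursiveIn_comp (recursiveIn_membersBelow B) hfind)
      (recursiveIn_of_primrec Primrec.id))).of_eq fun e => ?_
  simp [charFn, hcorrect e _ (Nat.find_spec (hex e))]

/-! ### Stages of the enumeration of the halting set -/

/-- The program with code `e` halts on input `e` within `s` steps. -/
def HaltsBy (s e : ℕ) : Prop :=
  ((Denumerable.ofNat Code e).evaln s e).isSome

theorem HaltsBy.mono {s t e : ℕ} (hst : s ≤ t) (h : HaltsBy s e) : HaltsBy t e := by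
  obtain ⟨x, hx⟩ := Option.isSome_iff_exists.1 h
  exact Option.isSome_iff_exists.2 ⟨x, Code.evaln_mono hst hx⟩

theorem mem_haltingSet_iff {e : ℕ} : e ∈ haltingSet ↔ ∃ s, HaltsBy s e := by
  constructor
  · intro h
    obtain ⟨x, hx⟩ := Part.dom_iff_mem.1 h
    obtain ⟨s, hs⟩ := Code.evaln_complete.1 hx
    exact ⟨s, Option.isSome_iff_exists.2 ⟨x, hs⟩⟩
  · rintro ⟨s, hs⟩
    obtain ⟨x, hx⟩ := Option.isSome_iff_exists.1 hs
    exact Part.dom_iff_mem.2 ⟨x, Code.evaln_sound hx⟩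

theorem primrecRel_haltsBy : PrimrecRel HaltsBy := by
  classical
  have h : Primrec fun p : ℕ × ℕ => ((Denumerable.ofNat Code p.2).evaln p.1 p.2).isSome :=
    Primrec.option_isSome.comp (Code.primrec_evaln.comp
      ((Primrec.fst.pair ((Primrec.ofNat Code).comp Primrec.snd)).pair Primrec.snd))
  exact Primrec.primrecPred (h.of_eq fun p => Bool.decide_eq_true.symm)

/-- `e` is seen to be in the halting set at stage `s + 1`, but not yet at stage `s`. -/
def Enters (s e : ℕ) : Prop :=
  ¬ HaltsBy s e ∧ HaltsBy (s + 1) e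

open Classical in
/-- The least `e < s` that enters the halting set at stage `s + 1`, and `s` if there is none. -/
noncomputable def leastEntering (s : ℕ) : ℕ :=
  Nat.findGreatest (fun k => ∀ e < k, ¬ Enters s e) s

theorem leastEntering_le_of_enters {s e : ℕ} (h : Enters s e) : leastEntering s ≤ e := by
  classical
  by_contra! hlt
  have := Nat.findGreatest_spec (P := fun k => ∀ e < k, ¬ Enters s e) (Nat.zero_le s) (by simp)
  exact this e hlt h

/-- Each number enters at most once, so from some stage on nothing up to `e` enters. -/
theorem exists_forall_lt_leastEntering (e : ℕ) : ∃ N, ∀ s ≥ N, e < leastEntering s := by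
  classical
  have hbound : ∃ N, ∀ x ≤ e, ∀ s ≥ N, ¬ Enters s x := by
    induction e with
    | zero =>
      by_cases h : ∃ s, HaltsBy s 0
      · obtain ⟨t, ht⟩ := h
        refine ⟨t, fun x hx s hs hE => hE.1 ?_⟩
        obtain rfl : x = 0 := by omega
        exact ht.mono hs
      · refine ⟨0, fun x hx s _ hE => h ⟨s + 1, ?_⟩⟩
        obtain rfl : x = 0 := by omega
        exact hE.2
    | succ e ih =>
      obtain ⟨N, hN⟩ := ih
      by_cases h : ∃ s, HaltsBy s (e + 1)
      · obtain ⟨t, ht⟩ := h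
        refine ⟨max N t, fun x hx s hs hE => ?_⟩
        rcases Nat.le_succ_iff.1 hx with hx | rfl
        · exact hN x hx s (le_trans (le_max_left _ _) hs) hE
        · exact hE.1 (ht.mono (le_trans (le_max_right _ _) hs))
      · refine ⟨N, fun x hx s hs hE => ?_⟩
        rcases Nat.le_succ_iff.1 hx with hx | rfl
        · exact hN x hx s hs hE
        · exact h ⟨s + 1, hE.2⟩
  obtain ⟨N, hN⟩ := hbound
  -- The bound `e + 1` is needed because `leastEntering s` never exceeds `s`.
  refine ⟨max N (e + 1), fun s hs => Nat.le_findGreatest (le_trans (le_max_right _ _) hs) ?_⟩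
  exact fun x hx => hN x (by omega) s (le_trans (le_max_left _ _) hs)

theorem primrec_leastEntering : Primrec leastEntering := by
  classical
  have hE : PrimrecRel fun e s : ℕ => ¬ Enters s e := by
    have h1 : PrimrecPred fun p : ℕ × ℕ => HaltsBy p.2 p.1 :=
      primrecRel_haltsBy.comp Primrec.snd Primrec.fst
    have h2 : PrimrecPred fun p : ℕ × ℕ => HaltsBy (p.2 + 1) p.1 :=
      primrecRel_haltsBy.comp (Primrec.succ.comp Primrec.snd) Primrec.fst
    exact (h1.not.and h2).not
  have hP : PrimrecRel fun s k : ℕ => ∀ e < k, ¬ Enters s e :=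
    hE.forall_lt.comp Primrec.snd Primrec.fst
  exact Primrec.nat_findGreatest Primrec.id hP

/-! ### True stages and the coloring -/

/-- Stage `s` still looks like a true stage for `g` at stage `t`: no later value of `g` up to `t`
is less than `g s`. -/
def LooksTrue (g : ℕ → ℕ) (s t : ℕ) : Prop :=
  ∀ u < t + 1, s < u → g s ≤ g u

/-- `s` is a true stage for `g`: no later value of `g` is less than `g s`. -/
def IsTrueStage (g : ℕ → ℕ) (s : ℕ) : Prop :=
  ∀ u, s < u → g s ≤ g u

theorem IsTrueStage.looksTrue {g : ℕ → ℕ} {s : ℕ} (h : IsTrueStage g s) (t : ℕ) :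
    LooksTrue g s t :=
  fun u _ hu => h u hu

theorem LooksTrue.mono {g : ℕ → ℕ} {s t t' : ℕ} (h : LooksTrue g s t) (ht : t' ≤ t) :
    LooksTrue g s t' :=
  fun u hu hsu => h u (by omega) hsu

theorem LooksTrue.trans {g : ℕ → ℕ} {s t u : ℕ} (hst : s ≤ t) (h : LooksTrue g s t)
    (h' : LooksTrue g t u) : LooksTrue g s u := by
  intro v hv hsv
  by_cases hvt : v ≤ t
  · exact h v (by omega) hsv
  · refine le_trans ?_ (h' v hv (by omega))
    rcases hst.eq_or_lt with rfl | hlt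
    · exact le_rfl
    · exact h t (by omega) hlt

theorem exists_min_ge (g : ℕ → ℕ) (N : ℕ) : ∃ s ≥ N, ∀ u ≥ N, g s ≤ g u := by
  have hne : (Set.Ici N).Nonempty := ⟨N, Set.mem_Ici.2 le_rfl⟩
  exact ⟨Function.argminOn g (Set.Ici N) hne, Function.argminOn_mem g _ hne,
    fun u hu => Function.argminOn_le g _ hu⟩

theorem exists_isTrueStage_ge (g : ℕ → ℕ) (N : ℕ) : ∃ s ≥ N, IsTrueStage g s := by
  obtain ⟨s, hs, hmin⟩ := exists_min_ge g N
  exact ⟨s, hs, fun u hu => hmin u (by omega)⟩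

theorem primrecRel_looksTrue {g : ℕ → ℕ} (hg : Primrec g) : PrimrecRel (LooksTrue g) := by
  have h : PrimrecRel fun u s : ℕ => s < u → g s ≤ g u := by
    have h1 : PrimrecPred fun p : ℕ × ℕ => p.2 < p.1 := Primrec.nat_lt.comp Primrec.snd Primrec.fst
    have h2 : PrimrecPred fun p : ℕ × ℕ => g p.2 ≤ g p.1 :=
      Primrec.nat_le.comp (hg.comp Primrec.snd) (hg.comp Primrec.fst)
    exact (h1.not.or h2).of_eq fun p => by tauto
  exact h.forall_lt.comp (Primrec.succ.comp Primrec.snd) Primrec.fst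

theorem primrec_log_four : Primrec (Nat.log 4) := by
  have hpow : Primrec fun k : ℕ => 4 ^ k :=
    (Primrec.nat_rec₁ 1 (Primrec.nat_mul.comp₂ Primrec₂.right (Primrec₂.const 4))).of_eq fun k => by
      induction k with
      | zero => rfl
      | succ k ih => simp [pow_succ, ← ih]
  have hP : PrimrecRel fun n k : ℕ => 4 ^ k ≤ n :=
    Primrec.nat_le.comp (hpow.comp Primrec.snd) Primrec.fst
  refine (Primrec.nat_findGreatest Primrec.id hP).of_eq fun n => ?_
  rw [Nat.findGreatest_eq_iff]
  refine ⟨Nat.log_le_self 4 n, fun h => Nat.pow_log_le_self 4 ?_, fun k hk _ => ?_⟩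
  · rintro rfl
    simp at h
  · exact not_le.2 (Nat.lt_pow_of_log_lt (by norm_num) hk)

open Classical in
/-- The color of `{x, y}` is `0` if the stage `Nat.log 4` of the smaller number still looks true at
the stage of the larger one, and `1` otherwise. -/
noncomputable def stageColor (g : ℕ → ℕ) (x y : ℕ) : Fin 2 :=
  if LooksTrue g (Nat.log 4 (min x y)) (Nat.log 4 (max x y)) then 0 else 1

/-- The coloring given by `stageColor`. -/
noncomputable def stageColoring (g : ℕ → ℕ) : Coloring 2 :=
  SimpleGraph.EdgeLabeling.mk (fun x y _ => stageColor g x y) fun x y _ => by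
    rw [stageColor, stageColor, min_comm, max_comm]

theorem stageColoring_get_of_lt {g : ℕ → ℕ} {x y : ℕ} (hlt : x < y) (h : x ≠ y) :
    (stageColoring g).get x y h = 0 ↔ LooksTrue g (Nat.log 4 x) (Nat.log 4 y) := by
  rw [stageColoring, SimpleGraph.EdgeLabeling.get_mk, stageColor, min_eq_left hlt.le,
    max_eq_right hlt.le]
  split_ifs with hT <;> simp [hT]

theorem stageColoring_get_of_gt {g : ℕ → ℕ} {x y : ℕ} (hlt : y < x) (h : x ≠ y) :
    (stageColoring g).get x y h = 0 ↔ LooksTrue g (Nat.log 4 y) (Nat.log 4 x) := by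
  rw [← stageColoring_get_of_lt hlt h.symm, SimpleGraph.EdgeLabeling.get_comm]

theorem stageColoring_isComputable {g : ℕ → ℕ} (hg : Primrec g) :
    (stageColoring g).IsComputable := by
  classical
  refine ⟨stageColor g, ?_, fun x y h => rfl⟩
  have hP : PrimrecPred fun p : ℕ × ℕ =>
      LooksTrue g (Nat.log 4 (min p.1 p.2)) (Nat.log 4 (max p.1 p.2)) :=
    (primrecRel_looksTrue hg).comp
      (primrec_log_four.comp (Primrec.nat_min.comp Primrec.fst Primrec.snd))
      (primrec_log_four.comp (Primrec.nat_max.comp Primrec.fst Primrec.snd))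
  exact (Primrec.ite hP (Primrec.const (0 : Fin 2)) (Primrec.const 1)).to_comp

/-- The limit color is 0 exactly at true stages: a stage `u` refuting truth is seen by every `y ≥ 4
^ u`. -/
theorem stageColoring_isStable (g : ℕ → ℕ) : (stageColoring g).IsStable := by
  intro x
  by_cases hx : IsTrueStage g (Nat.log 4 x)
  · refine ⟨0, ?_⟩
    filter_upwards [Filter.eventually_gt_atTop x] with y hy h
    exact (stageColoring_get_of_lt hy h).2 (hx.looksTrue _)
  · refine ⟨1, ?_⟩
    simp only [IsTrueStage, not_forall] at hx
    obtain ⟨u, hu, hgu⟩ := hx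
    filter_upwards [Filter.eventually_gt_atTop x, Filter.eventually_ge_atTop (4 ^ u)] with y hy hyu h
    refine Fin.eq_one_of_ne_zero _ fun h0 => hgu ?_
    refine (stageColoring_get_of_lt hy h).1 h0 u (Nat.lt_succ_of_le ?_) hu
    exact Nat.le_log_of_pow_le (by norm_num) hyu

/-! ### Path decompositions -/

section Decomposition

variable {g : ℕ → ℕ} {P : Fin 2 → Stream'.Seq ℕ}

theorem get_one_lt_of_isTrueStage (hP : IsPathDecomposition (stageColoring g) P) {s n x y : ℕ}
    (hs : IsTrueStage g s) (hx : Nat.log 4 x = s) (hn : (P 1).get? (n + 1) = some x)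
    (hy : (P 1).get? n = some y) : y < 4 ^ s := by
  have hne : y ≠ x := by
    rintro rfl
    have := (hP.isPath 1).distinct _ _ _ hn hy
    omega
  have hcol := (hP.isPath 1).color n y x hy hn hne
  have hcol0 : (stageColoring g).get y x hne ≠ 0 := by
    rw [hcol]
    decide
  by_contra! hge
  have hlog : s ≤ Nat.log 4 y := Nat.le_log_of_pow_le (by norm_num) hge
  rcases lt_or_gt_of_ne hne with hlt | hlt
  · refine hcol0 ((stageColoring_get_of_lt hlt hne).2 ?_)
    have : Nat.log 4 y = s := le_antisymm (hx ▸ Nat.log_mono_right hlt.le) hlog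
    rw [this]
    exact hs.looksTrue _
  · refine hcol0 ((stageColoring_get_of_gt hlt hne).2 ?_)
    rw [hx]
    exact hs.looksTrue _

/-- For a true stage `s`, more numbers have stage `s` than have a smaller stage, so that they cannot
all be on the path of color `1`. -/
theorem exists_get_zero_of_isTrueStage (hP : IsPathDecomposition (stageColoring g) P) {s : ℕ}
    (hs : IsTrueStage g s) : ∃ n x, 4 ^ s ≤ x ∧ (P 0).get? n = some x := by
  classical
  by_contra! hno
  have hone : ∀ x, 4 ^ s ≤ x → ∃ n, (P 1).get? n = some x := by
    intro x hx
    obtain ⟨j, ⟨n, hn⟩, -⟩ := hP.covers x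
    fin_cases j
    · exact absurd hn (hno n x hx)
    · exact ⟨n, hn⟩
  choose! pos hpos using hone
  have hpred : ∀ x ∈ Finset.Ico (4 ^ s) (4 ^ (s + 1)), pos x ≠ 0 →
      ∃ y < 4 ^ s, (P 1).get? (pos x - 1) = some y := by
    intro x hx hx0
    rw [Finset.mem_Ico] at hx
    obtain ⟨y, hy⟩ := (P 1).ge_stable (Nat.sub_le (pos x) 1) (hpos x hx.1)
    refine ⟨y, get_one_lt_of_isTrueStage hP hs (n := pos x - 1) (x := x) ?_ ?_ hy, hy⟩
    · exact Nat.log_eq_of_pow_le_of_lt_pow hx.1 hx.2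
    · rw [Nat.sub_add_cancel (Nat.pos_of_ne_zero hx0)]
      exact hpos x hx.1
  choose! prev hprev hprev' using hpred
  have hcard : (Finset.Ico (4 ^ s) (4 ^ (s + 1))).card ≤ (Finset.range (4 ^ s + 1)).card := by
    -- Predecessors on a path are distinct; the possible first entry of the path, having none, gets
    -- the spare value `4 ^ s`.
    refine Finset.card_le_card_of_injOn (fun x => if pos x = 0 then 4 ^ s else prev x) ?_ ?_
    · intro x hx
      by_cases h0 : pos x = 0
      · simp [h0]
      · have := hprev x hx h0
        simp only [h0, if_false, Finset.coe_range, Set.mem_Iio]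
        omega
    · intro x hx x' hx' hxx'
      have hmem := (Finset.mem_Ico.1 hx).1
      have hmem' := (Finset.mem_Ico.1 hx').1
      have key : pos x = pos x' := by
        by_cases h0 : pos x = 0 <;> by_cases h0' : pos x' = 0
        · rw [h0, h0']
        · have := hprev x' hx' h0'
          simp only [h0, h0', if_true, if_false] at hxx'
          omega
        · have := hprev x hx h0
          simp only [h0, h0', if_true, if_false] at hxx'
          omega
        · simp only [h0, h0', if_false] at hxx'
          have h1 := hprev' x hx h0
          rw [hxx'] at h1
          have := (hP.isPath 1).distinct _ _ _ h1 (hprev' x' hx' h0')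
          omega
      have h1 := hpos x hmem
      rw [key, hpos x' hmem'] at h1
      exact (Option.some_injective _ h1).symm
  -- Base 4 gives `3 * 4 ^ s > 4 ^ s + 1` even for `s = 0`, where base 3 would fail.
  rw [Nat.card_Ico, Finset.card_range, pow_succ] at hcard
  have : 0 < 4 ^ s := by positivity
  omega

/-- A finite path 0 would be bounded, yet it has entries beyond `4 ^ s` for arbitrarily late true
stages `s`. -/
theorem exists_get_zero (hP : IsPathDecomposition (stageColoring g) P) (n : ℕ) :
    ∃ x, (P 0).get? n = some x := by
  by_contra! hno
  have hnone : (P 0).get? n = none := Option.eq_none_iff_forall_ne_some.2 hno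
  obtain ⟨b, hb⟩ : ∃ b, ∀ m < n, ∀ x, (P 0).get? m = some x → x < b := by
    refine ⟨(Finset.range n).sup (fun m => ((P 0).get? m).getD 0) + 1, fun m hm x hx => ?_⟩
    have := Finset.le_sup (f := fun m => ((P 0).get? m).getD 0) (Finset.mem_range.2 hm)
    simp only [hx, Option.getD_some] at this
    omega
  obtain ⟨s, hs, htrue⟩ := exists_isTrueStage_ge g b
  obtain ⟨m, x, hx, hm⟩ := exists_get_zero_of_isTrueStage hP htrue
  have hmn : m < n := by
    by_contra! hge
    rw [(P 0).le_stable hge hnone] at hm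
    cases hm
  have h1 := hb m hmn x hm
  have h2 : s < 4 ^ s := Nat.lt_pow_self (by norm_num)
  omega

variable {a : ℕ → ℕ}

/-- An entry of the path of color `0` that is less than all later entries has a true stage. -/
theorem isTrueStage_of_forall_gt (hP : IsPathDecomposition (stageColoring g) P)
    (ha : ∀ n, (P 0).get? n = some (a n)) {i : ℕ} (hi : ∀ j, i < j → a i < a j) :
    IsTrueStage g (Nat.log 4 (a i)) := by
  have hinj : Function.Injective a := fun m n hmn =>
    (hP.isPath 0).distinct m n (a m) (ha m) (hmn ▸ ha n)
  have hle : ∀ j, i ≤ j → a i ≤ a j := fun j hj => by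
    rcases hj.eq_or_lt with rfl | hlt
    · exact le_rfl
    · exact (hi j hlt).le
  have hlook : ∀ j, i ≤ j → LooksTrue g (Nat.log 4 (a i)) (Nat.log 4 (a j)) := by
    intro j hj
    induction j, hj using Nat.le_induction with
    | base =>
      intro u hu hu'
      omega
    | succ j hj ih =>
      have hne : a j ≠ a (j + 1) := fun h => by
        have := hinj h
        omega
      -- An ascending edge of color 0 extends the window by transitivity; a descending one only
      -- shrinks it.
      rcases lt_or_gt_of_ne hne with hlt | hlt
      · refine ih.trans (Nat.log_mono_right (hle j hj)) ?_
        exact (stageColoring_get_of_lt hlt hne).1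
          ((hP.isPath 0).color j _ _ (ha j) (ha (j + 1)) hne)
      · exact ih.mono (Nat.log_mono_right hlt.le)
  intro u hu
  have htend := hinj.nat_tendsto_atTop
  obtain ⟨j, hj, hju⟩ := ((htend.eventually_ge_atTop (4 ^ u)).and
    (Filter.eventually_ge_atTop i)).exists
  exact hlook j hju u (Nat.lt_succ_of_le (Nat.le_log_of_pow_le (by norm_num) hj)) hu

/-- Infinitely many entries of an injective sequence are less than all later entries. -/
theorem exists_forall_gt {a : ℕ → ℕ} (ha : Function.Injective a) (N : ℕ) :
    ∃ i, N ≤ a i ∧ ∀ j, i < j → a i < a j := by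
  obtain ⟨i₀, hi₀⟩ := Filter.eventually_atTop.1 (ha.nat_tendsto_atTop.eventually_ge_atTop N)
  obtain ⟨i, hi, hmin⟩ := exists_min_ge a i₀
  refine ⟨i, hi₀ i hi, fun j hj => lt_of_le_of_ne (hmin j (by omega)) fun h => ?_⟩
  have := ha h
  omega

end Decomposition

/-! ### Computing the halting set from a path decomposition -/

/-- The entry coded by `q` is on the path of color `0`, its stage decides `e` if it is a true stage,
and `l` shows that the smaller numbers are not later entries of the same path. -/
def IsWitness (l : List ℕ) (e q : ℕ) : Prop :=
  q.unpair.1 = 0 ∧ e < leastEntering (Nat.log 4 q.unpair.2.unpair.2) ∧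
    ∀ x < q.unpair.2.unpair.2, ∃ p ∈ l, p.unpair.2.unpair.2 = x ∧
      (p.unpair.1 = 0 → p.unpair.2.unpair.1 < q.unpair.2.unpair.1)

theorem primrecPred_isWitness :
    PrimrecPred fun t : ℕ × List ℕ × ℕ => IsWitness t.2.1 t.2.2 t.1 := by
  have hcolor : Primrec fun q : ℕ => q.unpair.1 := Primrec.fst.comp Primrec.unpair
  have hrest : Primrec fun q : ℕ => q.unpair.2.unpair :=
    Primrec.unpair.comp (Primrec.snd.comp Primrec.unpair)
  have hpos : Primrec fun q : ℕ => q.unpair.2.unpair.1 := Primrec.fst.comp hrest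
  have hval : Primrec fun q : ℕ => q.unpair.2.unpair.2 := Primrec.snd.comp hrest
  have hentry : PrimrecRel fun (p : ℕ) (y : ℕ × ℕ) =>
      p.unpair.2.unpair.2 = y.1 ∧ (p.unpair.1 = 0 → p.unpair.2.unpair.1 < y.2) := by
    have h1 : PrimrecPred fun t : ℕ × ℕ × ℕ => t.1.unpair.2.unpair.2 = t.2.1 :=
      Primrec.eq.comp (hval.comp Primrec.fst) (Primrec.fst.comp Primrec.snd)
    have h2 : PrimrecPred fun t : ℕ × ℕ × ℕ => t.1.unpair.1 = 0 :=
      Primrec.eq.comp (hcolor.comp Primrec.fst) (Primrec.const 0)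
    have h3 : PrimrecPred fun t : ℕ × ℕ × ℕ => t.1.unpair.2.unpair.1 < t.2.2 :=
      Primrec.nat_lt.comp (hpos.comp Primrec.fst) (Primrec.snd.comp Primrec.snd)
    exact (h1.and (h2.not.or h3)).of_eq fun t => by tauto
  have hlist : PrimrecRel fun (x : ℕ) (y : List ℕ × ℕ) => ∃ p ∈ y.1,
      p.unpair.2.unpair.2 = x ∧ (p.unpair.1 = 0 → p.unpair.2.unpair.1 < y.2) :=
    hentry.exists_mem_list.comp (Primrec.fst.comp Primrec.snd)
      (Primrec.fst.pair (Primrec.snd.comp Primrec.snd))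
  have hall : PrimrecPred fun t : ℕ × List ℕ × ℕ => ∀ x < t.1.unpair.2.unpair.2, ∃ p ∈ t.2.1,
      p.unpair.2.unpair.2 = x ∧ (p.unpair.1 = 0 → p.unpair.2.unpair.1 < t.1.unpair.2.unpair.1) :=
    (hlist.forall_mem_list.comp (Primrec.list_range.comp (hval.comp Primrec.fst))
      ((Primrec.fst.comp Primrec.snd).pair (hpos.comp Primrec.fst))).of_eq fun t => by simp
  have hdecides : PrimrecPred fun t : ℕ × List ℕ × ℕ =>
      t.2.2 < leastEntering (Nat.log 4 t.1.unpair.2.unpair.2) :=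
    Primrec.nat_lt.comp (Primrec.snd.comp Primrec.snd)
      (primrec_leastEntering.comp (primrec_log_four.comp (hval.comp Primrec.fst)))
  have hzero : PrimrecPred fun t : ℕ × List ℕ × ℕ => t.1.unpair.1 = 0 :=
    Primrec.eq.comp (hcolor.comp Primrec.fst) (Primrec.const 0)
  exact hzero.and (hdecides.and hall)

/-- A true stage decides all numbers below its least entering number. -/
theorem mem_haltingSet_iff_of_isTrueStage {s e : ℕ} (hs : IsTrueStage leastEntering s)
    (he : e < leastEntering s) : e ∈ haltingSet ↔ HaltsBy (s + 1) e := by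
  rw [mem_haltingSet_iff]
  refine ⟨fun h => ?_, fun h => ⟨_, h⟩⟩
  classical
  by_contra hnot
  -- A later first halting time would make `e` enter at a stage `u > s`, so `g u ≤ e < g s` for `g =
  -- leastEntering`, against truth of `s`.
  have hlt : s + 1 < Nat.find h := by
    by_contra! hle
    exact hnot ((Nat.find_spec h).mono hle)
  obtain ⟨u, hu⟩ : ∃ u, Nat.find h = u + 1 := ⟨Nat.find h - 1, by omega⟩
  have henters : Enters u e := ⟨Nat.find_min h (by omega), hu ▸ Nat.find_spec h⟩
  have h1 := leastEntering_le_of_enters henters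
  have h2 := hs u (by omega)
  omega

section Decomposition

variable {P : Fin 2 → Stream'.Seq ℕ}

/-- Soundness of certificates: a smaller later entry of path 0 would be listed in the certificate,
and since its path and position are unique, it would have to come earlier. -/
theorem isTrueStage_of_isWitness (hP : IsPathDecomposition (stageColoring leastEntering) P)
    {e n q : ℕ} (hq : q ∈ graphSet P) (hw : IsWitness (membersBelow (graphSet P) n) e q) :
    IsTrueStage leastEntering (Nat.log 4 q.unpair.2.unpair.2) := by
  obtain ⟨hzero, -, hall⟩ := hw
  obtain ⟨j, i, x, hx, rfl⟩ := hq
  simp only [Nat.unpair_pair] at hzero hall ⊢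
  obtain rfl : j = 0 := Fin.ext hzero
  choose a ha using exists_get_zero hP
  obtain rfl : a i = x := Option.some_injective _ ((ha i).symm.trans hx)
  refine isTrueStage_of_forall_gt hP ha fun j hij => ?_
  have hne : a i ≠ a j := fun h => by
    have := (hP.isPath 0).distinct i j (a i) (ha i) (h ▸ ha j)
    omega
  by_contra! hle
  obtain ⟨p, hp, hpx, hpos⟩ := hall (a j) (lt_of_le_of_ne hle hne.symm)
  obtain ⟨k, m, y, hy, rfl⟩ := (mem_membersBelow.1 hp).1
  simp only [Nat.unpair_pair] at hpx hpos
  subst hpx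
  obtain rfl : k = 0 := (hP.covers (a j)).unique ⟨m, hy⟩ ⟨j, ha j⟩
  have h1 := (hP.isPath 0).distinct m j (a j) hy (ha j)
  have h2 := hpos rfl
  omega

theorem exists_isWitness (hP : IsPathDecomposition (stageColoring leastEntering) P) (e : ℕ) :
    ∃ n, ∃ q ∈ membersBelow (graphSet P) n, IsWitness (membersBelow (graphSet P) n) e q := by
  choose a ha using exists_get_zero hP
  have hinj : Function.Injective a := fun m n hmn =>
    (hP.isPath 0).distinct m n (a m) (ha m) (hmn ▸ ha n)
  obtain ⟨N, hN⟩ := exists_forall_lt_leastEntering e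
  obtain ⟨i, hNi, hi⟩ := exists_forall_gt hinj (4 ^ N)
  have hcode : ∀ x, ∃ p ∈ graphSet P, p.unpair.2.unpair.2 = x ∧
      (p.unpair.1 = 0 → (P 0).get? p.unpair.2.unpair.1 = some x) := by
    intro x
    obtain ⟨j, ⟨m, hm⟩, -⟩ := hP.covers x
    refine ⟨_, ⟨j, m, x, hm, rfl⟩, by simp, fun h => ?_⟩
    simp only [Nat.unpair_pair] at h ⊢
    obtain rfl : j = 0 := Fin.ext h
    exact hm
  choose code hmem hval hget using hcode
  have hq : Nat.pair 0 (Nat.pair i (a i)) ∈ graphSet P := ⟨0, i, a i, ha i, rfl⟩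
  -- Large enough for the finite part to contain the witness and the locations of all numbers below
  -- `a i`.
  set n := (Finset.range (a i)).sup code + Nat.pair 0 (Nat.pair i (a i)) + 1
  refine ⟨n, _, mem_membersBelow.2 ⟨hq, by omega⟩, ?_⟩
  simp only [IsWitness, Nat.unpair_pair, true_and]
  refine ⟨hN _ (Nat.le_log_of_pow_le (by norm_num) hNi), fun x hx => ?_⟩
  have hle := Finset.le_sup (f := code) (Finset.mem_range.2 hx)
  refine ⟨code x, mem_membersBelow.2 ⟨hmem x, by omega⟩, hval x, fun h0 => ?_⟩
  have hax : a (code x).unpair.2.unpair.1 = x :=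
    Option.some_injective _ ((ha _).symm.trans (hget x h0))
  by_contra! hge
  rcases hge.eq_or_lt with heq | hlt
  · rw [← heq] at hax
    omega
  · have := hi _ hlt
    omega

theorem computes_haltingSet (hP : IsPathDecomposition (stageColoring leastEntering) P) :
    Computes (graphSet P) haltingSet := by
  have hpair : PrimrecPred fun t : List ℕ × ℕ => ∃ q ∈ t.1, IsWitness t.1 t.2 q :=
    (PrimrecRel.exists_mem_list (R := fun (q : ℕ) (y : List ℕ × ℕ) => IsWitness y.1 y.2 q)
      primrecPred_isWitness).comp Primrec.fst Primrec.id
  have hhalts : PrimrecPred fun t : ℕ × List ℕ × ℕ =>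
      HaltsBy (Nat.log 4 t.1.unpair.2.unpair.2 + 1) t.2.2 :=
    primrecRel_haltsBy.comp (Primrec.succ.comp (primrec_log_four.comp (Primrec.snd.comp
      (Primrec.unpair.comp (Primrec.snd.comp (Primrec.unpair.comp Primrec.fst))))))
      (Primrec.snd.comp Primrec.snd)
  have hpair' : PrimrecPred fun t : List ℕ × ℕ => ∃ q ∈ t.1, IsWitness t.1 t.2 q ∧
      HaltsBy (Nat.log 4 q.unpair.2.unpair.2 + 1) t.2 :=
    (PrimrecRel.exists_mem_list (R := fun (q : ℕ) (y : List ℕ × ℕ) => IsWitness y.1 y.2 q ∧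
      HaltsBy (Nat.log 4 q.unpair.2.unpair.2 + 1) y.2)
      (primrecPred_isWitness.and hhalts)).comp Primrec.fst Primrec.id
  refine computes_of_search (H := fun l e => ∃ q ∈ l, IsWitness l e q)
    (R := fun l e => ∃ q ∈ l, IsWitness l e q ∧ HaltsBy (Nat.log 4 q.unpair.2.unpair.2 + 1) e)
    hpair hpair' (exists_isWitness hP) ?_
  -- Every certificate gives the correct answer, so it does not matter which one in the finite part
  -- is used.
  have hdec : ∀ e n q, q ∈ membersBelow (graphSet P) n →
      IsWitness (membersBelow (graphSet P) n) e q →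
      (e ∈ haltingSet ↔ HaltsBy (Nat.log 4 q.unpair.2.unpair.2 + 1) e) := fun e n q hq hw =>
    mem_haltingSet_iff_of_isTrueStage
      (isTrueStage_of_isWitness hP (mem_membersBelow.1 hq).1 hw) hw.2.1
  rintro e n ⟨q, hq, hw⟩
  constructor
  · rintro ⟨q', hq', hw', hh⟩
    exact (hdec e n q' hq' hw').2 hh
  · exact fun he => ⟨q, hq, hw, (hdec e n q hq hw).1 he⟩

end Decomposition

end RadoPath

theorem theorem3p1 :
    ∃ c : RadoPath.Coloring 2, c.IsComputable ∧ c.IsStable ∧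
      ∀ P : Fin 2 → Stream'.Seq ℕ, RadoPath.IsPathDecomposition c P →
        RadoPath.Computes (RadoPath.graphSet P) RadoPath.haltingSet :=
  ⟨RadoPath.stageColoring RadoPath.leastEntering,
    RadoPath.stageColoring_isComputable RadoPath.primrec_leastEntering,
    RadoPath.stageColoring_isStable _, fun _ hP => RadoPath.computes_haltingSet hP⟩
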